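/- Let $n\ge 0$ be an integer and let $\mathbb H^n=\mathbb C^n\times\mathbb R$ be the Heisenberg group with $(z,t)(w,s)=\bigl(z+w,\;t+s+\tfrac12\operatorname{Im}(z\cdot\bar w)\bigr)$ and Haar measure $dz\,dt$ (Lebesgue measure). For $f,g\in L^1(\mathbb H^n)$ put $f^*(z,t)=\overline{f(-z,-t)}$, $(f*g)(p)=\int_{\mathbb H^n}f(pq^{-1})\,g(q)\,dq$ and $(R_{p}f)(q)=f(qp)$. Let $\mathbb R^*=\mathbb R\setminus\{0\}$ with the measure $d\mu(\lambda)=(2\pi)^{-n-1}|\lambda|^n\,d\lambda$, and let $L^\infty(\mathbb R^*,B(L^2(\mathbb R^n)),d\mu)$ be the space of (weakly) measurable, $\mu$-essentially bounded functions from $\mathbb R^*$ to the bounded operators on $L^2(\mathbb R^n)$, with the essential supremum seminorm of the operator norm; its elements are functions defined at every $\lambda\in\mathbb R^*$, with pointwise linear operations. **Theorem.** Let $T:L^1(\mathbb H^n)\to L^\infty(\mathbb R^*,B(L^2(\mathbb R^n)),d\mu)$ be a nonzero continuous linear map such that for all $f,g\in L^1(\mathbb H^n)$, $\lambda\in\mathbb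 R^*$ and $t\in\mathbb R$ (i) $T(f^*)(\lambda)=(Tf)(\lambda)^*$ (the adjoint operator); (ii) $T(f*g)(\lambda)=(Tf)(\lambda)\,(Tg)(\lambda)$; (iii) $T(R_{(0,t)}f)(\lambda)=e^{-i\lambda t}\,(Tf)(\lambda)$. Let $A=\{\lambda\in\mathbb R^*: (Tf)(\lambda)\ne 0 \text{ for some } f\in L^1(\mathbb H^n)\}$. Then for each $\lambda\in A$ there is an orthogonal decomposition $L^2(\mathbb R^n)=\mathcal H^\lambda\oplus V^\lambda$ into closed subspaces, where $V^\lambda=\{v\in L^2(\mathbb R^n):(Tf)(\lambda)v=0\text{ for all }f\in L^1(\mathbb H^n)\}$, and a (strongly continuous) unitary representation $\rho_\lambda$ of $\mathbb H^n$ on $\mathcal H^\lambda$ such that $$(Tf)(\lambda)v=\int_{\mathbb H^n}f(z,t)\,\rho_\lambda(z,t)v\,dz\,dt\qquad\text{for all } f\in L^1(\mathbb H^n),\ v\in\mathcal H^\lambda,$$ the integral being absolutely convergent. In particular this holds for maps into $L^\infty(\mathbb R^*,S_2,d\mu)$, where $S_2\subset B(L^2(\mathbb R^n))$ is the space of Hilbert-Schmidt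 operators with the Hilbert-Schmidt norm. -/

import Mathlib

open MeasureTheory

noncomputable section

/-! ### The Heisenberg group -/

/-- The Heisenberg group of dimension `2 n + 1`: the manifold `ℂⁿ × ℝ`, with the group law below. -/
def Heis (n : ℕ) : Type := (Fin n → ℂ) × ℝ

namespace Heis

variable {n : ℕ}

instance : TopologicalSpace (Heis n) := inferInstanceAs (TopologicalSpace ((Fin n → ℂ) × ℝ))

/-- The measure is Lebesgue measure `dz dt` on `ℂⁿ × ℝ`. -/
instance : MeasureSpace (Heis n) := inferInstanceAs (MeasureSpace ((Fin n → ℂ) × ℝ))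

instance : BorelSpace (Heis n) := inferInstanceAs (BorelSpace ((Fin n → ℂ) × ℝ))

instance : SecondCountableTopology (Heis n) :=
  inferInstanceAs (SecondCountableTopology ((Fin n → ℂ) × ℝ))

instance : SigmaFinite (volume : Measure (Heis n)) :=
  inferInstanceAs (SigmaFinite (volume : Measure ((Fin n → ℂ) × ℝ)))

/-- `Im (z · w̄)`, where `z · w̄ = ∑ⱼ zⱼ w̄ⱼ`. -/
def sympl (z w : Fin n → ℂ) : ℝ := (∑ j, z j * star (w j)).im

/-- The element `(z, t)`. -/
def mk (z : Fin n → ℂ) (t : ℝ) : Heis n := (z, t)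

/-- The component `z ∈ ℂⁿ` of `(z, t)`. -/
def z (p : Heis n) : Fin n → ℂ := Prod.fst p

/-- The component `t ∈ ℝ` of `(z, t)`. -/
def t (p : Heis n) : ℝ := Prod.snd p

@[simp] theorem z_mk (z : Fin n → ℂ) (t : ℝ) : (mk z t).z = z := rfl

@[simp] theorem t_mk (z : Fin n → ℂ) (t : ℝ) : (mk z t).t = t := rfl

@[ext] theorem ext {p q : Heis n} (h : p.z = q.z) (h' : p.t = q.t) : p = q := Prod.ext h h'

/-- The group law `(z,t)(w,s) = (z + w, t + s + ½ Im (z · w̄))`. -/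
instance : Mul (Heis n) := ⟨fun p q => mk (p.z + q.z) (p.t + q.t + (1 / 2) * sympl p.z q.z)⟩

instance : One (Heis n) := ⟨mk 0 0⟩

instance : Inv (Heis n) := ⟨fun p => mk (-p.z) (-p.t)⟩

@[simp] theorem z_mul (p q : Heis n) : (p * q).z = p.z + q.z := rfl

@[simp] theorem t_mul (p q : Heis n) : (p * q).t = p.t + q.t + (1 / 2) * sympl p.z q.z := rfl

@[simp] theorem z_one : (1 : Heis n).z = 0 := rfl

@[simp] theorem t_one : (1 : Heis n).t = 0 := rfl

@[simp] theorem z_inv (p : Heis n) : (p⁻¹).z = -p.z := rfl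

@[simp] theorem t_inv (p : Heis n) : (p⁻¹).t = -p.t := rfl

theorem sympl_add_left (z z' w : Fin n → ℂ) : sympl (z + z') w = sympl z w + sympl z' w := by
  simp [sympl, add_mul, Finset.sum_add_distrib]

theorem sympl_add_right (z w w' : Fin n → ℂ) : sympl z (w + w') = sympl z w + sympl z w' := by
  simp [sympl, mul_add, Finset.sum_add_distrib]

theorem sympl_neg_self (z : Fin n → ℂ) : sympl (-z) z = 0 := by
  simp [sympl, Complex.im_sum]
  exact Finset.sum_eq_zero fun j _ => by ring

theorem sympl_zero_left (z : Fin n → ℂ) : sympl 0 z = 0 := by simp [sympl]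

theorem sympl_zero_right (z : Fin n → ℂ) : sympl z 0 = 0 := by simp [sympl]

instance : Group (Heis n) where
  mul_assoc a b c := by
    ext1
    · simp [add_assoc]
    · simp only [t_mul, z_mul, sympl_add_left, sympl_add_right]; ring
  one_mul a := by ext1 <;> simp [sympl_zero_left]
  mul_one a := by ext1 <;> simp [sympl_zero_right]
  inv_mul_cancel a := by ext1 <;> simp [sympl_neg_self]

theorem continuous_sympl : Continuous fun p : (Fin n → ℂ) × (Fin n → ℂ) => sympl p.1 p.2 := by
  unfold sympl
  fun_prop

instance : IsTopologicalGroup (Heis n) where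
  continuous_mul := by
    have h : Continuous fun x : ((Fin n → ℂ) × ℝ) × ((Fin n → ℂ) × ℝ) =>
        ((x.1.1 + x.2.1, x.1.2 + x.2.2 + (1 / 2) * sympl x.1.1 x.2.1) : (Fin n → ℂ) × ℝ) := by
      have := (continuous_sympl (n := n)).comp
        (((continuous_fst.comp continuous_fst).prodMk (continuous_fst.comp continuous_snd)) :
          Continuous fun x : ((Fin n → ℂ) × ℝ) × ((Fin n → ℂ) × ℝ) => (x.1.1, x.2.1))
      simp only [Function.comp_def] at this
      fun_prop
    exact h
  continuous_inv := by
    have h : Continuous fun x : (Fin n → ℂ) × ℝ => ((-x.1, -x.2) : (Fin n → ℂ) × ℝ) := by fun_prop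
    exact h

/-- Lebesgue measure is invariant under right translations. -/
instance : (volume : Measure (Heis n)).IsMulRightInvariant where
  map_mul_right_eq_self g := by
    have h1 : MeasurePreserving (fun z : Fin n → ℂ => z + g.z) volume volume :=
      measurePreserving_add_right _ _
    have hm : Measurable (Function.uncurry fun (z : Fin n → ℂ) (t : ℝ) =>
        t + g.t + (1 / 2) * sympl z g.z) := by
      have := (continuous_sympl (n := n)).comp
        (continuous_fst.prodMk continuous_const :
          Continuous fun x : (Fin n → ℂ) × ℝ => (x.1, g.z))
      simp only [Function.comp_def] at this
      exact Continuous.measurable (by unfold Function.uncurry; fun_prop)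
    have h2 : MeasurePreserving (fun p : (Fin n → ℂ) × ℝ =>
        (p.1 + g.z, p.2 + g.t + (1 / 2) * sympl p.1 g.z)) (volume.prod volume)
        (volume.prod volume) := by
      refine h1.skew_product hm (Filter.Eventually.of_forall fun z => ?_)
      simp only [add_assoc]
      exact (measurePreserving_add_right (volume : Measure ℝ) _).map_eq
    exact h2.map_eq

/-- Lebesgue measure is invariant under inversion. -/
instance : (volume : Measure (Heis n)).IsInvInvariant where
  inv_eq_self := by
    have h : MeasurePreserving (fun p : (Fin n → ℂ) × ℝ => (-p.1, -p.2)) (volume.prod volume)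
        (volume.prod volume) :=
      (Measure.measurePreserving_neg (volume : Measure (Fin n → ℂ))).prod
        (Measure.measurePreserving_neg (volume : Measure ℝ))
    exact h.map_eq

end Heis

/-! ### The convolution algebra `L¹` of the Heisenberg group -/

/-- `L¹(ℍⁿ)`. -/
abbrev HeisL1 (n : ℕ) : Type := Lp ℂ 1 (volume : Measure (Heis n))

namespace HeisL1

variable {n : ℕ}

theorem integrable_involution (f : HeisL1 n) :
    Integrable (fun p : Heis n => star (f p⁻¹)) volume :=
  (Complex.conjLIE.toContinuousLinearEquiv.toContinuousLinearMap).integrable_comp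
    (L1.integrable_coeFn f).comp_inv

theorem integrable_translate (g : Heis n) (f : HeisL1 n) :
    Integrable (fun p : Heis n => f (p * g)) volume :=
  (L1.integrable_coeFn f).comp_mul_right g

theorem integrable_convolution (f g : HeisL1 n) :
    Integrable (fun p : Heis n => ∫ q : Heis n, f (p * q⁻¹) * g q) volume := by
  have h := (L1.integrable_coeFn f).mul_prod (L1.integrable_coeFn g)
  have h2 := (measurePreserving_div_prod (volume : Measure (Heis n))
    (volume : Measure (Heis n))).integrable_comp_of_integrable h
  simp only [Function.comp_def, div_eq_mul_inv] at h2
  exact h2.integral_prod_left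

/-- The involution `f*(z,t) = conj f(-z,-t)`. -/
def involution (f : HeisL1 n) : HeisL1 n := (integrable_involution f).toL1 _

/-- Right translation `(R_g f)(p) = f(p g)`. -/
def rightTranslate (g : Heis n) (f : HeisL1 n) : HeisL1 n := (integrable_translate g f).toL1 _

/-- The convolution `(f * g)(p) = ∫ f(p q⁻¹) g(q) dq`. -/
def conv (f g : HeisL1 n) : HeisL1 n := (integrable_convolution f g).toL1 _

end HeisL1

/-! ### Unitary representations -/

/-- A (strongly continuous) unitary representation of the Heisenberg group on `H`. -/
structure HeisUnitaryRep (n : ℕ) (H : Type*) [NormedAddCommGroup H] [InnerProductSpace ℂ H] where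
  toHom : Heis n →* (H ≃ₗᵢ[ℂ] H)
  continuous_apply : ∀ v : H, Continuous fun g : Heis n => toHom g v

/-! ### Essentially bounded operator-valued functions on `ℝ* = ℝ \ {0}` -/

/-- `ℝ* = ℝ \ {0}`. -/
abbrev RStar : Type := {l : ℝ // l ≠ 0}

/-- The measure `dμ(λ) = (2π)^(-n-1) |λ|ⁿ dλ` on `ℝ*`. -/
def plancherelMeasure (n : ℕ) : Measure RStar :=
  (Measure.comap ((↑) : RStar → ℝ) volume).withDensity fun l =>
    ENNReal.ofReal (((2 * Real.pi) ^ (n + 1))⁻¹ * |(l : ℝ)| ^ n)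

/-- `L²(ℝⁿ)`. -/
abbrev RnL2 (n : ℕ) : Type := Lp ℂ 2 (volume : Measure (EuclideanSpace ℝ (Fin n)))

/-- The bounded operators on `L²(ℝⁿ)`. -/
abbrev RnOp (n : ℕ) : Type := RnL2 n →L[ℂ] RnL2 n

section EssSup

variable {α : Type*} [MeasurableSpace α] (μ : Measure α) (K : Type*)
  [NormedAddCommGroup K] [InnerProductSpace ℂ K]

variable {K} in
/-- The essential supremum of the operator norms `‖F λ‖`. -/
def opEssSup (F : α → K →L[ℂ] K) : ENNReal := essSup (fun l => ‖F l‖ₑ) μ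

variable {μ K}

theorem opEssSup_zero : opEssSup μ (0 : α → K →L[ℂ] K) = 0 := by
  have h : ‖(0 : K →L[ℂ] K)‖ₑ = 0 := by rw [← ofReal_norm, norm_zero, ENNReal.ofReal_zero]
  simp only [opEssSup, Pi.zero_apply, h]
  exact le_antisymm (essSup_le_of_ae_le 0 (Filter.Eventually.of_forall fun _ => le_rfl)) bot_le

theorem opEssSup_add_le (F G : α → K →L[ℂ] K) :
    opEssSup μ (F + G) ≤ opEssSup μ F + opEssSup μ G :=
  (essSup_mono_ae (Filter.Eventually.of_forall fun x => enorm_add_le (F x) (G x))).trans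
    (ENNReal.essSup_add_le _ _)

theorem opEssSup_smul_le (c : ℂ) (F : α → K →L[ℂ] K) :
    opEssSup μ (c • F) ≤ ‖c‖ₑ * opEssSup μ F := by
  simp only [opEssSup, Pi.smul_apply, enorm_smul]
  exact ENNReal.essSup_const_mul.le

variable (μ K)

/-- The functions on a measure space with values in the bounded operators on a Hilbert space `K`
that are (weakly) measurable and essentially bounded. These are functions with a value at every
point, not classes of functions. -/
def linftySubmodule : Submodule ℂ (α → K →L[ℂ] K) where
  carrier := {F | (∀ φ ψ : K, AEMeasurable (fun l => inner ℂ φ (F l ψ)) μ) ∧ opEssSup μ F < ⊤}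
  zero_mem' := by
    refine ⟨fun φ ψ => ?_, ?_⟩
    · simp only [Pi.zero_apply, zero_apply, inner_zero_right]
      exact aemeasurable_const
    · rw [opEssSup_zero]; exact ENNReal.zero_lt_top
  add_mem' := by
    rintro F G ⟨hF, hF'⟩ ⟨hG, hG'⟩
    refine ⟨fun φ ψ => ?_,
      (opEssSup_add_le F G).trans_lt (ENNReal.add_lt_top.2 ⟨hF', hG'⟩)⟩
    simp only [Pi.add_apply, add_apply, inner_add_right]
    exact (hF φ ψ).add (hG φ ψ)
  smul_mem' := by
    rintro c F ⟨hF, hF'⟩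
    refine ⟨fun φ ψ => ?_,
      (opEssSup_smul_le c F).trans_lt (ENNReal.mul_lt_top ENNReal.coe_lt_top hF')⟩
    simp only [Pi.smul_apply, smul_apply, inner_smul_right]
    exact (hF φ ψ).const_mul c

/-- The essential supremum as a seminorm. -/
def essSupNorm : Seminorm ℂ (linftySubmodule μ K) :=
  Seminorm.ofSMulLE (fun F => (opEssSup μ F.1).toReal)
    (by
      change (opEssSup μ (0 : α → K →L[ℂ] K)).toReal = 0
      rw [opEssSup_zero, ENNReal.toReal_zero])
    (fun F G => by
      change (opEssSup μ (F.1 + G.1)).toReal ≤ _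
      rw [← ENNReal.toReal_add F.2.2.ne G.2.2.ne]
      exact ENNReal.toReal_mono (ENNReal.add_lt_top.2 ⟨F.2.2, G.2.2⟩).ne (opEssSup_add_le _ _))
    (fun c F => by
      change (opEssSup μ (c • F.1)).toReal ≤ _
      have h : ‖c‖ = (‖c‖ₑ).toReal := (toReal_enorm c).symm
      rw [h, ← ENNReal.toReal_mul]
      exact ENNReal.toReal_mono (ENNReal.mul_lt_top ENNReal.coe_lt_top F.2.2).ne
        (opEssSup_smul_le _ _))

end EssSup

/-- The space `L^∞(ℝ*, B(L²(ℝⁿ)), dμ)` of essentially bounded functions, with the essential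
supremum (semi)norm. -/
def LInftyOp (n : ℕ) : Type := linftySubmodule (plancherelMeasure n) (RnL2 n)

namespace LInftyOp

variable {n : ℕ}

instance : AddCommGroup (LInftyOp n) :=
  inferInstanceAs (AddCommGroup (linftySubmodule (plancherelMeasure n) (RnL2 n)))

instance : Module ℂ (LInftyOp n) :=
  inferInstanceAs (Module ℂ (linftySubmodule (plancherelMeasure n) (RnL2 n)))

instance : CoeFun (LInftyOp n) (fun _ => RStar → RnOp n) := ⟨fun F => F.1⟩

/-- The topology on `L^∞` is the one of the essential supremum (semi)norm. -/
instance : SeminormedAddCommGroup (LInftyOp n) :=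
  (essSupNorm (plancherelMeasure n) (RnL2 n)).toAddGroupSeminorm.toSeminormedAddCommGroup

instance : NormedSpace ℂ (LInftyOp n) :=
  { (inferInstance : Module ℂ (LInftyOp n)) with
    norm_smul_le := fun c F => (map_smul_eq_mul (essSupNorm (plancherelMeasure n) (RnL2 n)) c F).le }

end LInftyOp

/-- The set `A` of all `λ` such that `(T f)(λ) ≠ 0` for some `f`. -/
def supportSet {n : ℕ} (T : HeisL1 n →L[ℂ] LInftyOp n) : Set RStar :=
  {l | ∃ f : HeisL1 n, T f l ≠ 0}

/-- The space `{v : (T f)(λ) v = 0 for all f}`. -/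
def commonNullSpace {n : ℕ} (T : HeisL1 n →L[ℂ] LInftyOp n) (l : RStar) :
    Submodule ℂ (RnL2 n) :=
  ⨅ f : HeisL1 n, LinearMap.ker (T f l : RnL2 n →ₗ[ℂ] RnL2 n)

end

/-!
Evaluation at a fixed `λ` turns `T` into a *-representation `π` of the convolution algebra
`L¹(ℍⁿ)` on `L²(ℝⁿ)`, and the theorem is the correspondence between nondegenerate
*-representations of `L¹` and unitary representations of the group.

The essential supremum seminorm does not see single points, so the continuity of `T` says nothing
about `π`. But a *-homomorphism from a Banach *-algebra to a C*-algebra is automatically contractive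
(`norm_map_le_of_star_hom`): for self-adjoint `π(x)` with `‖x‖ < 1` a Neumann series in `L¹` inverts
`1 - π(x)`, which bounds the spectral radius, hence the norm, of `π(x)`; the general case follows
from `‖π(x)‖² = ‖π(x* x)‖`.

Let `H` be the closed span of the vectors `π(f) v`. As `π` is compatible with adjoints, `Hᗮ` is the
common null space (`orthogonal_essentialSpace`). On `H` the representation is determined by
`ρ(g) π(f) v = π(L_g f) v`, where `L_g` is left translation: this is well defined and isometric
because `(L_g f)* * (L_g h) = f* * h` (`inner_formalEval_formalTranslate`), and strongly continuous
because `π` is bounded and translation is continuous in `L¹`. Finally `f * h = ∫ f(g) L_g h dg` as a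
Bochner integral in `L¹` (`HeisL1.conv_eq_integral`); applying `π` gives the integral formula on the
vectors `π(h) v`, and it extends to `H` by density (`integrated_essentialRep`).
-/

noncomputable section

/-! ### Left translations and convolution in `L¹` -/

namespace Heis

variable {n : ℕ}

instance : T2Space (Heis n) := inferInstanceAs (T2Space ((Fin n → ℂ) × ℝ))

instance : IsLocallyFiniteMeasure (volume : Measure (Heis n)) :=
  inferInstanceAs (IsLocallyFiniteMeasure (volume : Measure ((Fin n → ℂ) × ℝ)))

instance : (volume : Measure (Heis n)).InnerRegularCompactLTTop :=
  inferInstanceAs (volume : Measure ((Fin n → ℂ) × ℝ)).InnerRegularCompactLTTop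

/-- Left translation by `g` is the right translation by `g⁻¹` conjugated by the inversion, so right
invariance and inversion invariance of the measure give left invariance. -/
instance : (volume : Measure (Heis n)).IsMulLeftInvariant where
  map_mul_left_eq_self g := by
    have h : MeasurePreserving (fun p : Heis n => ((p⁻¹) * g⁻¹)⁻¹) volume volume :=
      (Measure.measurePreserving_inv volume).comp
        ((measurePreserving_mul_right volume g⁻¹).comp (Measure.measurePreserving_inv volume))
    simpa using h.map_eq

end Heis

namespace HeisL1

variable {n : ℕ}

/-- Left translation `(L_g f)(p) = f(g⁻¹ p)`, through the action of the opposite group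
`(Heis n)ᵈᵐᵃ` on `L¹`. -/
def leftTranslate (g : Heis n) (f : HeisL1 n) : HeisL1 n := DomMulAct.mk g⁻¹ • f

theorem coeFn_leftTranslate (g : Heis n) (f : HeisL1 n) :
    leftTranslate g f =ᵐ[volume] fun p => f (g⁻¹ * p) :=
  DomMulAct.smul_Lp_ae_eq _ _

theorem norm_leftTranslate (g : Heis n) (f : HeisL1 n) : ‖leftTranslate g f‖ = ‖f‖ :=
  DomMulAct.norm_smul_Lp _ _

theorem leftTranslate_one (f : HeisL1 n) : leftTranslate 1 f = f := by
  simp [leftTranslate]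

theorem leftTranslate_mul (g h : Heis n) (f : HeisL1 n) :
    leftTranslate (g * h) f = leftTranslate g (leftTranslate h f) := by
  simp [leftTranslate, smul_smul]

theorem leftTranslate_add (g : Heis n) (f h : HeisL1 n) :
    leftTranslate g (f + h) = leftTranslate g f + leftTranslate g h :=
  smul_add _ _ _

theorem leftTranslate_smul (g : Heis n) (c : ℂ) (f : HeisL1 n) :
    leftTranslate g (c • f) = c • leftTranslate g f :=
  smul_comm _ _ _

theorem continuous_leftTranslate (f : HeisL1 n) : Continuous fun g => leftTranslate g f := by
  have : Fact ((1 : ENNReal) ≠ ⊤) := ⟨by simp⟩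
  have h : Continuous fun g : Heis n => DomMulAct.mk g⁻¹ :=
    DomMulAct.continuous_mk.comp continuous_inv
  exact h.smul continuous_const

theorem integrable_smul_leftTranslate (f h : HeisL1 n) :
    Integrable (fun g : Heis n => f g • leftTranslate g h) volume := by
  refine (L1.integrable_coeFn f).smul_bdd ‖h‖
    (continuous_leftTranslate h).aestronglyMeasurable ?_
  exact Filter.Eventually.of_forall fun g => (norm_leftTranslate g h).le

/-- Convolution is an average of left translates, as a Bochner integral in `L¹`. The two sides are
compared by integrating over sets of finite measure. -/
theorem conv_eq_integral (f h : HeisL1 n) :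
    conv f h = ∫ g : Heis n, f g • leftTranslate g h := by
  apply Lp.ext
  refine Lp.ae_eq_of_forall_setIntegral_eq _ _ one_ne_zero (by simp)
    (fun s _ _ => (L1.integrable_coeFn _).integrableOn)
    (fun s _ _ => (L1.integrable_coeFn _).integrableOn) fun s hs hfin => ?_
  have hF : Integrable (fun x : Heis n × Heis n => f x.1 * h (x.1⁻¹ * x.2))
      (volume.prod volume) :=
    (measurePreserving_prod_inv_mul (volume : Measure (Heis n)) volume).integrable_comp_of_integrable
      ((L1.integrable_coeFn f).mul_prod (L1.integrable_coeFn h))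
  have hF' : Integrable (fun x : Heis n × Heis n => f x.1 * h (x.1⁻¹ * x.2))
      (volume.prod (volume.restrict s)) := by
    refine hF.mono_measure ?_
    exact Measure.prod_mono le_rfl Measure.restrict_le_self
  have h1 : ∀ p : Heis n, ∫ q, f (p * q⁻¹) * h q = ∫ g, f g * h (g⁻¹ * p) := fun p => by
    rw [← integral_div_left_eq_self (fun g => f g * h (g⁻¹ * p)) volume p]
    simp [div_eq_mul_inv, mul_assoc]
  let φ : HeisL1 n →L[ℂ] ℂ :=
    (L1.integralCLM' ℂ).comp (LpToLpRestrictCLM (Heis n) ℂ ℂ volume 1 s)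
  have hφ : ∀ k : HeisL1 n, φ k = ∫ p in s, k p := fun k => by
    rw [← integral_congr_ae (LpToLpRestrictCLM_coeFn ℂ s k), ← L1.integral_eq_integral,
      L1.integral_eq' ℂ]
    rfl
  calc ∫ p in s, conv f h p = ∫ p in s, ∫ q, f (p * q⁻¹) * h q :=
        integral_congr_ae (ae_restrict_of_ae (Integrable.coeFn_toL1 _))
    _ = ∫ p in s, ∫ g, f g * h (g⁻¹ * p) := by simp only [h1]
    _ = ∫ g, ∫ p in s, f g * h (g⁻¹ * p) := (integral_integral_swap hF').symm
    _ = ∫ g, f g * ∫ p in s, leftTranslate g h p := by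
        congr 1; ext g
        rw [integral_const_mul]
        congr 1
        exact integral_congr_ae (ae_restrict_of_ae (coeFn_leftTranslate g h).symm)
    _ = _ := by
        rw [← hφ, ← φ.integral_comp_comm (integrable_smul_leftTranslate f h)]
        simp only [map_smul, smul_eq_mul, ← hφ]

theorem conv_add_left (f f' h : HeisL1 n) : conv (f + f') h = conv f h + conv f' h := by
  simp only [conv_eq_integral]
  rw [← integral_add (integrable_smul_leftTranslate f h) (integrable_smul_leftTranslate f' h)]
  refine integral_congr_ae ?_
  filter_upwards [Lp.coeFn_add f f'] with g hg
  rw [hg, Pi.add_apply, add_smul]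

theorem conv_smul_left (c : ℂ) (f h : HeisL1 n) : conv (c • f) h = c • conv f h := by
  simp only [conv_eq_integral]
  rw [← integral_smul]
  refine integral_congr_ae ?_
  filter_upwards [Lp.coeFn_smul c f] with g hg
  rw [hg, Pi.smul_apply, smul_assoc]

theorem conv_add_right (f h h' : HeisL1 n) : conv f (h + h') = conv f h + conv f h' := by
  simp only [conv_eq_integral, leftTranslate_add, smul_add]
  exact integral_add (integrable_smul_leftTranslate f h) (integrable_smul_leftTranslate f h')

theorem conv_smul_right (c : ℂ) (f h : HeisL1 n) : conv f (c • h) = c • conv f h := by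
  simp only [conv_eq_integral, leftTranslate_smul, smul_comm _ c]
  exact integral_smul _ _

theorem norm_conv_le (f h : HeisL1 n) : ‖conv f h‖ ≤ ‖f‖ * ‖h‖ := by
  rw [conv_eq_integral, L1.norm_eq_integral_norm f, ← integral_mul_const]
  refine (norm_integral_le_integral_norm _).trans_eq ?_
  simp only [norm_smul, norm_leftTranslate]

/-- Convolution as a continuous bilinear map of norm at most `1`. -/
def convCLM (n : ℕ) : HeisL1 n →L[ℂ] HeisL1 n →L[ℂ] HeisL1 n :=
  LinearMap.mkContinuous₂
    (LinearMap.mk₂ ℂ conv conv_add_left conv_smul_left conv_add_right conv_smul_right) 1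
    fun f h => by simpa using norm_conv_le f h

theorem coeFn_involution (f : HeisL1 n) : involution f =ᵐ[volume] fun p => star (f p⁻¹) :=
  Integrable.coeFn_toL1 _

theorem norm_involution (f : HeisL1 n) : ‖involution f‖ = ‖f‖ := by
  rw [L1.norm_eq_integral_norm, L1.norm_eq_integral_norm,
    ← integral_inv_eq_self (fun p => ‖f p‖) volume]
  refine integral_congr_ae ?_
  filter_upwards [coeFn_involution f] with p hp
  rw [hp, norm_star]

/-- Left translations act isometrically for the `L¹`-valued inner product `f* * h`. -/
theorem conv_involution_leftTranslate (x : Heis n) (f h : HeisL1 n) :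
    conv (involution (leftTranslate x f)) (leftTranslate x h) = conv (involution f) h := by
  rw [conv_eq_integral, conv_eq_integral,
    ← integral_mul_right_eq_self (fun g => involution f g • leftTranslate g h) x]
  refine integral_congr_ae ?_
  have h1 := (measurePreserving_mul_right (volume : Measure (Heis n)) x).quasiMeasurePreserving.ae
    (coeFn_involution f)
  have h2 := (Measure.measurePreserving_inv (volume : Measure (Heis n))).quasiMeasurePreserving.ae
    (coeFn_leftTranslate x f)
  filter_upwards [coeFn_involution (leftTranslate x f), h1, h2] with g hg hg1 hg2
  rw [hg, hg1, hg2, leftTranslate_mul, mul_inv_rev]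

end HeisL1

/-! ### Automatic continuity of *-representations -/

section AutomaticContinuity

variable {E B : Type*} [NormedAddCommGroup E] [NormedSpace ℂ E] [CompleteSpace E] [CStarAlgebra B]
  {m : E →L[ℂ] E →L[ℂ] E} {π : E →ₗ[ℂ] B}

/-- The solution `y` of `y = x + x y`, given by a Neumann series, yields the right inverse
`1 + π y` of `1 - π x`; for self-adjoint `π x` its adjoint is a left inverse. -/
theorem isUnit_one_sub_map_of_norm_lt_one (hm : ∀ x y, ‖m x y‖ ≤ ‖x‖ * ‖y‖)
    (hmul : ∀ x y, π (m x y) = π x * π y) {x : E} (hx : ‖x‖ < 1) (hsa : IsSelfAdjoint (π x)) :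
    IsUnit (1 - π x) := by
  have hC : ‖m x‖ < 1 := ((m x).opNorm_le_bound (norm_nonneg x) (hm x)).trans_lt hx
  obtain ⟨u, hu⟩ := isUnit_one_sub_of_norm_lt_one hC
  set y : E := (↑u⁻¹ : E →L[ℂ] E) x
  have hy : y - m x y = x := by
    have h : ((↑u : E →L[ℂ] E) * (↑u⁻¹ : E →L[ℂ] E)) x = x := by simp
    rw [hu] at h
    exact h
  have hr : (1 - π x) * (1 + π y) = 1 := by
    have h : π y - π x * π y = π x := by rw [← hmul, ← map_sub, hy]
    calc (1 - π x) * (1 + π y) = 1 - π x + (π y - π x * π y) := by noncomm_ring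
      _ = 1 := by rw [h]; abel
  have hl : star (1 + π y) * (1 - π x) = 1 := by
    simpa [hsa.star_eq] using congrArg star hr
  exact isUnit_iff_exists_and_exists.2 ⟨⟨_, hr⟩, ⟨_, hl⟩⟩

theorem norm_map_le_of_isSelfAdjoint (hm : ∀ x y, ‖m x y‖ ≤ ‖x‖ * ‖y‖)
    (hmul : ∀ x y, π (m x y) = π x * π y) {x : E} (hsa : IsSelfAdjoint (π x)) :
    ‖π x‖ ≤ ‖x‖ := by
  nontriviality B
  by_contra! hlt
  have key : ∀ r : ℝ, |r| = ‖π x‖ → r ∉ spectrum ℝ (π x) := by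
    intro r hr
    have hpos : 0 < |r| := hr ▸ (norm_nonneg x).trans_lt hlt
    have hr0 : (r : ℂ) ≠ 0 := by simpa using hpos
    have hnorm : ‖(r : ℂ)⁻¹ • x‖ < 1 := by
      rw [norm_smul, norm_inv, Complex.norm_real, Real.norm_eq_abs, inv_mul_lt_one₀ hpos, hr]
      exact hlt
    have hmap : π ((r : ℂ)⁻¹ • x) = (r : ℂ)⁻¹ • π x := map_smul _ _ _
    have hsa' : IsSelfAdjoint (π ((r : ℂ)⁻¹ • x)) := by
      rw [hmap, IsSelfAdjoint, star_smul, hsa.star_eq]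
      simp
    have hu := isUnit_one_sub_map_of_norm_lt_one hm hmul hnorm hsa'
    rw [spectrum.notMem_iff]
    have : algebraMap ℝ B r - π x = (Units.mk0 (r : ℂ) hr0) • (1 - π ((r : ℂ)⁻¹ • x)) := by
      rw [hmap, Units.smul_def, Units.val_mk0, smul_sub, smul_smul, mul_inv_cancel₀ hr0, one_smul,
        Algebra.algebraMap_eq_smul_one, Complex.coe_smul]
    rw [this]
    exact hu.smul _
  rcases CStarAlgebra.norm_or_neg_norm_mem_spectrum hsa with h | h
  · exact key _ (by simp) h
  · exact key _ (by simp) h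

/-- A *-homomorphism from a Banach *-algebra to a C*-algebra is contractive. -/
theorem norm_map_le_of_star_hom (hm : ∀ x y, ‖m x y‖ ≤ ‖x‖ * ‖y‖)
    (hmul : ∀ x y, π (m x y) = π x * π y) {i : E → E} (hi : ∀ x, ‖i x‖ = ‖x‖)
    (hstar : ∀ x, π (i x) = star (π x)) (x : E) : ‖π x‖ ≤ ‖x‖ := by
  have h : π (m (i x) x) = star (π x) * π x := by rw [hmul, hstar]
  have h1 : ‖π (m (i x) x)‖ ≤ ‖m (i x) x‖ :=
    norm_map_le_of_isSelfAdjoint hm hmul (h ▸ IsSelfAdjoint.star_mul_self _)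
  rw [h, CStarRing.norm_star_mul_self] at h1
  have h2 := h1.trans (hm _ _)
  rw [hi] at h2
  exact (mul_self_le_mul_self_iff (norm_nonneg _) (norm_nonneg _)).2 h2

end AutomaticContinuity

/-! ### The unitary representation attached to a *-representation of `L¹` -/

section Integration

variable {n : ℕ} {K : Type*} [NormedAddCommGroup K] [InnerProductSpace ℂ K]

/-- The linear map `∑ f ⊗ v ↦ ∑ π(f) v` on formal sums, whose range is the span of the vectors
`π(f) v`. -/
def formalEval (π : HeisL1 n →ₗ[ℂ] K →L[ℂ] K) : (HeisL1 n →₀ K) →ₗ[ℂ] K :=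
  Finsupp.lsum ℂ fun f => (π f : K →ₗ[ℂ] K)

@[simp] theorem formalEval_single (π : HeisL1 n →ₗ[ℂ] K →L[ℂ] K) (f : HeisL1 n) (v : K) :
    formalEval π (Finsupp.single f v) = π f v := by
  simp [formalEval]

/-- The essential space of `π`: the closed span of the vectors `π(f) v`. -/
def essentialSpace (π : HeisL1 n →ₗ[ℂ] K →L[ℂ] K) : Submodule ℂ K :=
  (LinearMap.range (formalEval π)).topologicalClosure

theorem isClosed_essentialSpace (π : HeisL1 n →ₗ[ℂ] K →L[ℂ] K) :
    IsClosed (essentialSpace π : Set K) :=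
  Submodule.isClosed_topologicalClosure _

/-- `formalEval` with values in the essential space, where its range is dense. -/
def essentialEval (π : HeisL1 n →ₗ[ℂ] K →L[ℂ] K) : (HeisL1 n →₀ K) →ₗ[ℂ] essentialSpace π :=
  (formalEval π).codRestrict _ fun e =>
    Submodule.le_topologicalClosure _ (LinearMap.mem_range_self _ e)

@[simp] theorem coe_essentialEval (π : HeisL1 n →ₗ[ℂ] K →L[ℂ] K) (e : HeisL1 n →₀ K) :
    (essentialEval π e : K) = formalEval π e := rfl

theorem denseRange_essentialEval (π : HeisL1 n →ₗ[ℂ] K →L[ℂ] K) :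
    DenseRange (essentialEval π) := by
  rw [DenseRange, Subtype.dense_iff, ← Set.range_comp]
  exact fun x hx => hx

/-- Left translation by `g` on formal sums. -/
def formalTranslate (g : Heis n) : (HeisL1 n →₀ K) ≃ₗ[ℂ] (HeisL1 n →₀ K) :=
  Finsupp.domLCongr
    { toFun := HeisL1.leftTranslate g
      invFun := HeisL1.leftTranslate g⁻¹
      left_inv := fun f => by
        rw [← HeisL1.leftTranslate_mul, inv_mul_cancel, HeisL1.leftTranslate_one]
      right_inv := fun f => by
        rw [← HeisL1.leftTranslate_mul, mul_inv_cancel, HeisL1.leftTranslate_one] }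

@[simp] theorem formalTranslate_single (g : Heis n) (f : HeisL1 n) (v : K) :
    formalTranslate g (Finsupp.single f v) = Finsupp.single (HeisL1.leftTranslate g f) v :=
  Finsupp.domLCongr_single _ _ _

theorem formalTranslate_one (e : HeisL1 n →₀ K) : formalTranslate 1 e = e := by
  induction e using Finsupp.induction_linear with
  | zero => simp
  | add a b ha hb => rw [map_add, ha, hb]
  | single f v => rw [formalTranslate_single, HeisL1.leftTranslate_one]

theorem formalTranslate_mul (g h : Heis n) (e : HeisL1 n →₀ K) :
    formalTranslate (g * h) e = formalTranslate g (formalTranslate h e) := by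
  induction e using Finsupp.induction_linear with
  | zero => simp
  | add a b ha hb => simp only [map_add, ha, hb]
  | single f v => simp only [formalTranslate_single, HeisL1.leftTranslate_mul]

theorem HeisUnitaryRep.integrable_smul {H : Submodule ℂ K} (ρ : HeisUnitaryRep n H)
    (f : HeisL1 n) (v : H) : Integrable fun g : Heis n => f g • (ρ.toHom g v : K) := by
  refine (L1.integrable_coeFn f).smul_bdd ‖v‖
    (continuous_subtype_val.comp (ρ.continuous_apply v)).aestronglyMeasurable ?_
  exact Filter.Eventually.of_forall fun g => ((ρ.toHom g).norm_map v).le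

/-- The operator `v ↦ ∫ f(g) ρ(g) v dg`. -/
def HeisUnitaryRep.integrated {H : Submodule ℂ K} (ρ : HeisUnitaryRep n H) (f : HeisL1 n) :
    H →L[ℂ] K :=
  LinearMap.mkContinuous
    { toFun := fun v => ∫ g : Heis n, f g • (ρ.toHom g v : K)
      map_add' := fun v w => by
        rw [← integral_add (ρ.integrable_smul f v) (ρ.integrable_smul f w)]
        simp only [map_add, Submodule.coe_add, smul_add]
      map_smul' := fun c v => by
        simp only [map_smul, Submodule.coe_smul, smul_comm _ c, RingHom.id_apply]
        exact integral_smul _ _ } ‖f‖ fun v => by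
      rw [L1.norm_eq_integral_norm f, ← integral_mul_const]
      refine (norm_integral_le_integral_norm _).trans_eq ?_
      simp only [norm_smul, Submodule.norm_coe, LinearIsometryEquiv.norm_map]

variable [CompleteSpace K]

instance (π : HeisL1 n →ₗ[ℂ] K →L[ℂ] K) : CompleteSpace (essentialSpace π) :=
  (isClosed_essentialSpace π).completeSpace_coe

theorem HeisL1.norm_map_le {π : HeisL1 n →ₗ[ℂ] K →L[ℂ] K}
    (hstar : ∀ f, π (HeisL1.involution f) = ContinuousLinearMap.adjoint (π f))
    (hmul : ∀ f h, π (HeisL1.conv f h) = π f * π h) (f : HeisL1 n) : ‖π f‖ ≤ ‖f‖ :=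
  norm_map_le_of_star_hom (m := HeisL1.convCLM n) HeisL1.norm_conv_le hmul HeisL1.norm_involution
    hstar f

/-- The orthogonal complement of the essential space is the common null space, because `π` is
compatible with adjoints. -/
theorem orthogonal_essentialSpace {π : HeisL1 n →ₗ[ℂ] K →L[ℂ] K}
    (hstar : ∀ f, π (HeisL1.involution f) = ContinuousLinearMap.adjoint (π f))
    (hmul : ∀ f h, π (HeisL1.conv f h) = π f * π h) :
    (essentialSpace π)ᗮ = ⨅ f, LinearMap.ker (π f : K →ₗ[ℂ] K) := by
  rw [essentialSpace, Submodule.orthogonal_closure]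
  ext u
  simp only [Submodule.mem_orthogonal, Submodule.mem_iInf, LinearMap.mem_ker,
    ContinuousLinearMap.coe_coe, LinearMap.mem_range, forall_exists_index,
    forall_apply_eq_imp_iff]
  constructor
  · intro h f
    -- `‖π(f) u‖² = ⟨π(f* * f) u, u⟩`.
    have h1 := h (Finsupp.single (HeisL1.conv (HeisL1.involution f) f) u)
    rw [formalEval_single, hmul, hstar, mul_apply_eq_comp,
      ContinuousLinearMap.adjoint_inner_left] at h1
    exact inner_self_eq_zero.1 h1
  · intro h e
    induction e using Finsupp.induction_linear with
    | zero => simp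
    | add a b ha hb => rw [map_add, inner_add_left, ha, hb, add_zero]
    | single f v =>
      rw [formalEval_single, ← ContinuousLinearMap.adjoint_inner_right, ← hstar, h, inner_zero_right]

/-- `⟨π(L_g f) v, π(L_g h) w⟩ = ⟨v, π((L_g f)* * L_g h) w⟩` does not depend on `g`. -/
theorem inner_formalEval_formalTranslate {π : HeisL1 n →ₗ[ℂ] K →L[ℂ] K}
    (hstar : ∀ f, π (HeisL1.involution f) = ContinuousLinearMap.adjoint (π f))
    (hmul : ∀ f h, π (HeisL1.conv f h) = π f * π h) (g : Heis n) (e e' : HeisL1 n →₀ K) :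
    inner ℂ (formalEval π (formalTranslate g e)) (formalEval π (formalTranslate g e')) =
      inner ℂ (formalEval π e) (formalEval π e') := by
  have key : ∀ (f h : HeisL1 n) (v w : K),
      inner ℂ (π f v) (π h w) = inner ℂ v (π (HeisL1.conv (HeisL1.involution f) h) w) := by
    intro f h v w
    rw [hmul, hstar, mul_apply_eq_comp, ContinuousLinearMap.adjoint_inner_right]
  induction e using Finsupp.induction_linear with
  | zero => simp
  | add a b ha hb => simp only [map_add, inner_add_left, ha, hb]
  | single f v =>
    induction e' using Finsupp.induction_linear with
    | zero => simp
    | add a b ha hb => simp only [map_add, inner_add_right, ha, hb]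
    | single h w =>
      simp only [formalTranslate_single, formalEval_single, key,
        HeisL1.conv_involution_leftTranslate]

theorem norm_essentialEval_formalTranslate {π : HeisL1 n →ₗ[ℂ] K →L[ℂ] K}
    (hstar : ∀ f, π (HeisL1.involution f) = ContinuousLinearMap.adjoint (π f))
    (hmul : ∀ f h, π (HeisL1.conv f h) = π f * π h) (g : Heis n) (e : HeisL1 n →₀ K) :
    ‖essentialEval π (formalTranslate g e)‖ = ‖essentialEval π e‖ := by
  simp only [Submodule.coe_norm, coe_essentialEval, @norm_eq_sqrt_re_inner ℂ K,
    inner_formalEval_formalTranslate hstar hmul]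

/-- The unitary operator with `π(f) v ↦ π(L_g f) v`. -/
def essentialTranslate {π : HeisL1 n →ₗ[ℂ] K →L[ℂ] K}
    (hstar : ∀ f, π (HeisL1.involution f) = ContinuousLinearMap.adjoint (π f))
    (hmul : ∀ f h, π (HeisL1.conv f h) = π f * π h) (g : Heis n) :
    essentialSpace π ≃ₗᵢ[ℂ] essentialSpace π :=
  (formalTranslate g).extendOfIsometry (essentialEval π) (essentialEval π)
    (denseRange_essentialEval π) (denseRange_essentialEval π)
    (norm_essentialEval_formalTranslate hstar hmul g)

theorem essentialTranslate_essentialEval {π : HeisL1 n →ₗ[ℂ] K →L[ℂ] K}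
    (hstar : ∀ f, π (HeisL1.involution f) = ContinuousLinearMap.adjoint (π f))
    (hmul : ∀ f h, π (HeisL1.conv f h) = π f * π h) (g : Heis n) (e : HeisL1 n →₀ K) :
    essentialTranslate hstar hmul g (essentialEval π e) = essentialEval π (formalTranslate g e) :=
  LinearEquiv.extendOfIsometry_eq _ _ _ _ _ _ _

theorem continuous_formalEval_formalTranslate {π : HeisL1 n →ₗ[ℂ] K →L[ℂ] K}
    (hstar : ∀ f, π (HeisL1.involution f) = ContinuousLinearMap.adjoint (π f))
    (hmul : ∀ f h, π (HeisL1.conv f h) = π f * π h) (e : HeisL1 n →₀ K) :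
    Continuous fun g : Heis n => formalEval π (formalTranslate g e) := by
  have hπ : Continuous π := AddMonoidHomClass.continuous_of_bound π 1 fun f => by
    simpa using HeisL1.norm_map_le hstar hmul f
  induction e using Finsupp.induction_linear with
  | zero => simpa using continuous_const
  | add a b ha hb =>
    simp only [map_add]
    exact ha.add hb
  | single f v =>
    simp only [formalTranslate_single, formalEval_single]
    exact (hπ.comp (HeisL1.continuous_leftTranslate f)).clm_apply continuous_const

theorem continuous_essentialTranslate {π : HeisL1 n →ₗ[ℂ] K →L[ℂ] K}
    (hstar : ∀ f, π (HeisL1.involution f) = ContinuousLinearMap.adjoint (π f))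
    (hmul : ∀ f h, π (HeisL1.conv f h) = π f * π h) (v : essentialSpace π) :
    Continuous fun g : Heis n => essentialTranslate hstar hmul g v := by
  -- The operators are isometric, so orbit maps of nearby vectors are uniformly close.
  refine continuous_of_uniform_approx_of_continuous fun u hu => ?_
  obtain ⟨ε, hε, hεu⟩ := Metric.mem_uniformity_dist.1 hu
  obtain ⟨w, hw, e, rfl⟩ : ∃ w, dist v w < ε ∧ w ∈ Set.range (essentialEval π) := by
    obtain ⟨e, he⟩ := (denseRange_essentialEval π).exists_dist_lt v hε
    exact ⟨_, he, e, rfl⟩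
  refine ⟨fun g => essentialTranslate hstar hmul g (essentialEval π e), ?_, fun g => hεu ?_⟩
  · simp only [essentialTranslate_essentialEval]
    exact (continuous_formalEval_formalTranslate hstar hmul e).subtype_mk _
  · rwa [LinearIsometryEquiv.dist_map]

/-- The unitary representation on the essential space through which `π` factors. -/
def essentialRep {π : HeisL1 n →ₗ[ℂ] K →L[ℂ] K}
    (hstar : ∀ f, π (HeisL1.involution f) = ContinuousLinearMap.adjoint (π f))
    (hmul : ∀ f h, π (HeisL1.conv f h) = π f * π h) : HeisUnitaryRep n (essentialSpace π) where
  toHom :=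
    { toFun := essentialTranslate hstar hmul
      map_one' := by
        refine LinearIsometryEquiv.ext fun v => ?_
        refine (denseRange_essentialEval π).induction_on v
          (isClosed_eq (essentialTranslate hstar hmul 1).continuous continuous_id) fun e => ?_
        rw [essentialTranslate_essentialEval, formalTranslate_one]
        rfl
      map_mul' := fun g h => by
        refine LinearIsometryEquiv.ext fun v => ?_
        refine (denseRange_essentialEval π).induction_on v
          (isClosed_eq (LinearIsometryEquiv.continuous _) (LinearIsometryEquiv.continuous _))
          fun e => ?_
        change _ = essentialTranslate hstar hmul g (essentialTranslate hstar hmul h _)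
        simp only [essentialTranslate_essentialEval, formalTranslate_mul] }
  continuous_apply := continuous_essentialTranslate hstar hmul

/-- On a vector `π(h) v` the integral formula is `π(f * h) = ∫ f(g) π(L_g h) dg`, which follows from
`HeisL1.conv_eq_integral` and the boundedness of `π`; the general case is by density. -/
theorem integrated_essentialRep {π : HeisL1 n →ₗ[ℂ] K →L[ℂ] K}
    (hstar : ∀ f, π (HeisL1.involution f) = ContinuousLinearMap.adjoint (π f))
    (hmul : ∀ f h, π (HeisL1.conv f h) = π f * π h) (f : HeisL1 n) (v : essentialSpace π) :
    (essentialRep hstar hmul).integrated f v = π f v := by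
  refine (denseRange_essentialEval π).induction_on v (isClosed_eq
    (ContinuousLinearMap.continuous _) ((π f).continuous.comp continuous_subtype_val)) fun e => ?_
  induction e using Finsupp.induction_linear with
  | zero => simp
  | add a b ha hb => simp only [map_add, ha, hb, Submodule.coe_add]
  | single h w =>
    let Φ : HeisL1 n →L[ℂ] K :=
      LinearMap.mkContinuous (((ContinuousLinearMap.apply ℂ K w : (K →L[ℂ] K) →ₗ[ℂ] K)).comp π) ‖w‖
        fun k => by
          refine ((π k).le_opNorm w).trans ?_
          rw [mul_comm]
          gcongr
          exact HeisL1.norm_map_le hstar hmul k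
    have hΦ : ∀ k, Φ k = π k w := fun k => rfl
    calc (essentialRep hstar hmul).integrated f (essentialEval π (Finsupp.single h w))
        = ∫ g : Heis n, f g • (essentialTranslate hstar hmul g
            (essentialEval π (Finsupp.single h w)) : K) := rfl
      _ = ∫ g : Heis n, Φ (f g • HeisL1.leftTranslate g h) := by
        simp only [essentialTranslate_essentialEval, coe_essentialEval, formalTranslate_single,
          formalEval_single, Φ.map_smul, hΦ]
      _ = Φ (HeisL1.conv f h) := by
        rw [Φ.integral_comp_comm (HeisL1.integrable_smul_leftTranslate f h),
          HeisL1.conv_eq_integral]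
      _ = π f (essentialEval π (Finsupp.single h w) : K) := by
        rw [hΦ, hmul, coe_essentialEval, formalEval_single, mul_apply_eq_comp]

end Integration

/-! ### The operator-valued map at a fixed point `λ` -/

theorem theorem4p1 (n : ℕ) (T : HeisL1 n →L[ℂ] LInftyOp n) (hT : T ≠ 0)
    (hstar : ∀ (f : HeisL1 n) (l : RStar),
      T (HeisL1.involution f) l = ContinuousLinearMap.adjoint (T f l))
    (hconv : ∀ (f g : HeisL1 n) (l : RStar), T (HeisL1.conv f g) l = T f l * T g l)
    (htrans : ∀ (f : HeisL1 n) (t : ℝ) (l : RStar),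
      T (HeisL1.rightTranslate (Heis.mk 0 t) f) l =
        Complex.exp (-(Complex.I * (l : ℝ) * t)) • T f l) :
    ∀ l ∈ supportSet T, ∃ H V : Submodule ℂ (RnL2 n),
      V = commonNullSpace T l ∧
      IsClosed (H : Set (RnL2 n)) ∧ IsClosed (V : Set (RnL2 n)) ∧ H ⟂ V ∧ IsCompl H V ∧
      ∃ ρ : HeisUnitaryRep n H, ∀ (f : HeisL1 n) (v : H),
        Integrable (fun g : Heis n => f g • (ρ.toHom g v : RnL2 n)) ∧
        T f l (v : RnL2 n) = ∫ g : Heis n, f g • (ρ.toHom g v : RnL2 n) := by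
  intro l _
  -- Elements of `LInftyOp` are functions with pointwise operations, so evaluation at `l` is linear
  -- and yields a *-representation of `L¹` at every `l`, without exceptional null sets.
  let π : HeisL1 n →ₗ[ℂ] RnOp n :=
    { toFun := fun f => T f l
      map_add' := fun f h => by rw [map_add]; rfl
      map_smul' := fun c f => by rw [map_smul]; rfl }
  have hs : ∀ f, π (HeisL1.involution f) = ContinuousLinearMap.adjoint (π f) :=
    fun f => hstar f l
  have hm : ∀ f h, π (HeisL1.conv f h) = π f * π h := fun f h => hconv f h l
  refine ⟨essentialSpace π, (essentialSpace π)ᗮ, orthogonal_essentialSpace hs hm,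
    isClosed_essentialSpace π, Submodule.isClosed_orthogonal _,
    Submodule.isOrtho_orthogonal_right _,
    Submodule.isCompl_orthogonal _, essentialRep hs hm, fun f v => ⟨?_, ?_⟩⟩
  · exact (essentialRep hs hm).integrable_smul f v
  · exact (integrated_essentialRep hs hm f v).symm
end
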